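/- Let $\Gamma$ be a countable discrete group acting by homeomorphisms on a compact space $X$, and let $\Gamma$ act on the algebra $C(X)$ of continuous complex-valued functions by $(s.f)(x)=f(s^{-1}x)$. Let $\lambda$ denote left translation, $(\lambda(s)\xi)(t)=\xi(s^{-1}t)$. A non-empty set $\Lambda\subseteq\Gamma$ is called plump if for every $\varepsilon>0$ and all $t_1,\dots,t_n\in\Gamma\setminus\{e\}$ there are $m\ge 1$ and $s_1,\dots,s_m\in\Lambda$ with $$\Big\|\frac1m\sum_{j=1}^m\lambda(s_jt_is_j^{-1})\Big\|<\varepsilon\quad\text{for all } i=1,\dots,n,$$ where the norm is the operator norm on $\ell^2(\Gamma)$. Let $\pi:C(X)\to\mathbb B(H)$ be a faithful unital $*$-representation on a complex Hilbert space $H$. On $\ell^2(\Gamma,H)$ put $(\sigma(a)\xi)(t)=\pi(t^{-1}.a)\,\xi(t)$ for $a\in C(X)$. The reduced crossed product $C(X)\rtimes_r\Gamma$ is the C*-algebra of operators on $\ell^2(\Gamma,H)$ generated by all $\sigma(a)$, $a\in C(X)$, and $\lambda(s)$, $s\in\Gamma$ (equivalently, the closed linear span of the operators $\sigma(a)\lambda(s)$).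 It contains the C*-algebra $C^*_r(\Gamma)$ generated by the operators $\lambda(s)$, $s\in\Gamma$, and, through $\sigma$, the algebra $C(X)$. The canonical conditional expectation $\mathbb E:C(X)\rtimes_r\Gamma\to C(X)$ is the continuous linear map with $\mathbb E(\sigma(a)\lambda(s))=a$ if $s=e$ and $0$ if $s\neq e$. **Theorem.** Suppose that for every $f\in C(X)$ and every $\varepsilon>0$ the set $$\Lambda^f_\varepsilon=\{s\in\Gamma:\ \|s.f-f\|_\infty<\varepsilon\}$$ is plump. Then $C(X)\rtimes_r\Gamma$ is almost reflecting: every C*-algebra $\mathcal A$ with $C^*_r(\Gamma)\subseteq\mathcal A\subseteq C(X)\rtimes_r\Gamma$ satisfies $\sigma(\mathbb E(\mathcal A))\subseteq\mathcal A$. -/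

import Mathlib

open scoped ENNReal

noncomputable section

namespace CrossedProduct

/-- The Hilbert space `ℓ²(Γ, H)` of square summable `H`-valued functions on `Γ`. -/
abbrev L2 (Γ H : Type*) [NormedAddCommGroup H] : Type _ := lp (fun _ : Γ => H) 2

section Translation

variable {Γ : Type*} [Group Γ] {H : Type*} [NormedAddCommGroup H]

theorem memℓp_translate (s : Γ) (ξ : L2 Γ H) : Memℓp (fun t : Γ => ξ (s⁻¹ * t)) 2 := by
  have h := (lp.memℓp ξ).summable (by norm_num)
  exact memℓp_gen ((Equiv.mulLeft s⁻¹).summable_iff.2 h)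

variable [InnerProductSpace ℂ H]

/-- The left translation `(λ_s ξ)(t) = ξ(s⁻¹ t)` on `ℓ²(Γ, H)`, as a bounded operator. -/
def translation (H : Type*) [NormedAddCommGroup H] [InnerProductSpace ℂ H] (s : Γ) :
    L2 Γ H →L[ℂ] L2 Γ H :=
  LinearMap.mkContinuous
    { toFun := fun ξ => ⟨fun t => ξ (s⁻¹ * t), memℓp_translate s ξ⟩
      map_add' := fun _ _ => rfl
      map_smul' := fun _ _ => rfl } 1 (by
    intro ξ
    rw [one_mul]
    have h2 : (0 : ℝ) < (2 : ℝ≥0∞).toReal := by norm_num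
    refine lp.norm_le_of_tsum_le h2 (norm_nonneg _) ?_
    rw [lp.norm_rpow_eq_tsum h2]
    exact ((Equiv.mulLeft s⁻¹).tsum_eq (fun t => ‖ξ t‖ ^ (2 : ℝ≥0∞).toReal)).le)

@[simp]
theorem translation_apply (s : Γ) (ξ : L2 Γ H) (t : Γ) :
    translation H s ξ t = ξ (s⁻¹ * t) := rfl

/-- The left regular representation `λ` of `Γ` on `ℓ²(Γ, H)`. For `H = ℂ` this is the usual left
regular representation on `ℓ²(Γ)`. -/
def leftReg (Γ : Type*) [Group Γ] (H : Type*) [NormedAddCommGroup H] [InnerProductSpace ℂ H] :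
    Γ →* (L2 Γ H →L[ℂ] L2 Γ H) where
  toFun := translation H
  map_one' := by
    ext ξ t
    simp
  map_mul' s t := by
    ext ξ u
    simp [mul_assoc]

@[simp]
theorem leftReg_apply (s : Γ) (ξ : L2 Γ H) (t : Γ) : leftReg Γ H s ξ t = ξ (s⁻¹ * t) := rfl

theorem star_leftReg [CompleteSpace H] (s : Γ) :
    star (leftReg Γ H s) = leftReg Γ H s⁻¹ := by
  rw [ContinuousLinearMap.star_eq_adjoint]
  symm
  rw [ContinuousLinearMap.eq_adjoint_iff]
  intro ξ η
  rw [lp.inner_eq_tsum, lp.inner_eq_tsum,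
    ← (Equiv.mulLeft s).tsum_eq (fun t => inner ℂ (ξ t) (leftReg Γ H s η t))]
  simp

/-- A subset `Λ` of `Γ` is plump if it is non-empty and, for every `ε > 0` and all finitely many
non-identity elements `t`, there are `s₁, …, s_m ∈ Λ` (with `m ≥ 1`, repetitions allowed) such that
`‖(1/m) ∑ⱼ λ(sⱼ t sⱼ⁻¹)‖ < ε` for each of these `t`, the norm being the one of bounded operators on
`ℓ²(Γ)`. -/
def IsPlump (Λ : Set Γ) : Prop :=
  Λ.Nonempty ∧ ∀ ε : ℝ, 0 < ε → ∀ F : Finset Γ, (1 : Γ) ∉ F →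
    ∃ (m : ℕ) (s : Fin m → Γ), 0 < m ∧ (∀ j, s j ∈ Λ) ∧
      ∀ t ∈ F, ‖(m : ℂ)⁻¹ • ∑ j, leftReg Γ ℂ (s j * t * (s j)⁻¹)‖ < ε

end Translation

section Flow

variable {Γ : Type*} [Group Γ] {X : Type*} [TopologicalSpace X]
  [MulAction Γ X] [ContinuousConstSMul Γ X]

/-- The action of `Γ` on `C(X)` induced by a flow: `(s.f)(x) = f(s⁻¹ x)`. -/
def act (s : Γ) : C(X, ℂ) →⋆ₐ[ℂ] C(X, ℂ) :=
  ContinuousMap.compStarAlgHom' ℂ ℂ ⟨fun x => s⁻¹ • x, continuous_const_smul s⁻¹⟩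

@[simp]
theorem act_apply (s : Γ) (f : C(X, ℂ)) (x : X) : act s f x = f (s⁻¹ • x) := rfl

theorem act_one (f : C(X, ℂ)) : act (1 : Γ) f = f := by
  ext x
  simp

theorem act_mul (s t : Γ) (f : C(X, ℂ)) : act (s * t) f = act s (act t f) := by
  ext x
  simp [mul_smul]

variable [CompactSpace X]

/-- The set `{s ∈ Γ : ‖s.f - f‖_∞ < ε}`. -/
def almostFixing (Γ : Type*) [Group Γ] {X : Type*} [TopologicalSpace X] [CompactSpace X]
    [MulAction Γ X] [ContinuousConstSMul Γ X] (f : C(X, ℂ)) (ε : ℝ) : Set Γ :=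
  {s | ‖act s f - f‖ < ε}

theorem norm_act_le (s : Γ) (f : C(X, ℂ)) : ‖act s f‖ ≤ ‖f‖ :=
  (ContinuousMap.norm_le _ (norm_nonneg f)).2 fun x => f.norm_coe_le_norm (s⁻¹ • x)

variable {H : Type*} [NormedAddCommGroup H] [InnerProductSpace ℂ H] [CompleteSpace H]
  (π : C(X, ℂ) →⋆ₐ[ℂ] (H →L[ℂ] H))

theorem norm_rep_act_apply_le (t : Γ) (a : C(X, ℂ)) (v : H) :
    ‖π (act t⁻¹ a) v‖ ≤ ‖a‖ * ‖v‖ :=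
  (ContinuousLinearMap.le_opNorm _ _).trans (mul_le_mul_of_nonneg_right
    ((NonUnitalStarAlgHom.norm_apply_le π _).trans (norm_act_le _ _)) (norm_nonneg v))

theorem norm_rep_act_apply_le' (t : Γ) (a : C(X, ℂ)) (v : H) :
    ‖π (act t⁻¹ a) v‖ ≤ ‖(‖a‖ : ℂ) • v‖ := by
  rw [norm_smul, Complex.norm_real, norm_norm]
  exact norm_rep_act_apply_le π t a v

theorem memℓp_diag (a : C(X, ℂ)) (ξ : L2 Γ H) :
    Memℓp (fun t : Γ => π (act t⁻¹ a) (ξ t)) 2 :=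
  (lp.memℓp ((‖a‖ : ℂ) • ξ)).mono' fun t => norm_rep_act_apply_le' π t a (ξ t)

/-- The bounded operator `(σ(a) ξ)(t) = π(t⁻¹.a) ξ(t)` on `ℓ²(Γ, H)`. -/
def diag (Γ : Type*) [Group Γ] {X : Type*} [TopologicalSpace X] [CompactSpace X]
    [MulAction Γ X] [ContinuousConstSMul Γ X]
    {H : Type*} [NormedAddCommGroup H] [InnerProductSpace ℂ H] [CompleteSpace H]
    (π : C(X, ℂ) →⋆ₐ[ℂ] (H →L[ℂ] H)) (a : C(X, ℂ)) : L2 Γ H →L[ℂ] L2 Γ H :=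
  LinearMap.mkContinuous
    { toFun := fun ξ => ⟨fun t => π (act t⁻¹ a) (ξ t), memℓp_diag π a ξ⟩
      map_add' := fun ξ η => by
        ext t
        exact map_add (π (act t⁻¹ a)) (ξ t) (η t)
      map_smul' := fun c ξ => by
        ext t
        exact map_smul (π (act t⁻¹ a)) c (ξ t) } ‖a‖ (by
    intro ξ
    have h : ‖(‖a‖ : ℂ) • ξ‖ = ‖a‖ * ‖ξ‖ := by
      rw [norm_smul, Complex.norm_real, norm_norm]
    rw [← h]
    exact lp.norm_mono (by norm_num) fun t => norm_rep_act_apply_le' π t a (ξ t))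

@[simp]
theorem diag_apply (a : C(X, ℂ)) (ξ : L2 Γ H) (t : Γ) :
    diag Γ π a ξ t = π (act t⁻¹ a) (ξ t) := rfl

/-- The `*`-representation `σ` of `C(X)` on `ℓ²(Γ, H)` induced by the representation `π` on `H`,
namely `(σ(a) ξ)(t) = π(t⁻¹.a) ξ(t)`. -/
def sigma (Γ : Type*) [Group Γ] {X : Type*} [TopologicalSpace X] [CompactSpace X]
    [MulAction Γ X] [ContinuousConstSMul Γ X]
    {H : Type*} [NormedAddCommGroup H] [InnerProductSpace ℂ H] [CompleteSpace H]
    (π : C(X, ℂ) →⋆ₐ[ℂ] (H →L[ℂ] H)) : C(X, ℂ) →⋆ₐ[ℂ] (L2 Γ H →L[ℂ] L2 Γ H) where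
  toFun := diag Γ π
  map_one' := by
    ext ξ t
    simp
  map_mul' a b := by
    ext ξ t
    simp
  map_zero' := by
    ext ξ t
    simp
  map_add' a b := by
    ext ξ t
    simp
  commutes' c := by
    ext ξ t
    simp only [diag_apply, AlgHomClass.commutes]
    rfl
  map_star' a := by
    rw [ContinuousLinearMap.star_eq_adjoint, ContinuousLinearMap.eq_adjoint_iff]
    intro ξ η
    rw [lp.inner_eq_tsum, lp.inner_eq_tsum]
    congr 1
    ext t
    rw [diag_apply, diag_apply, map_star, map_star, ContinuousLinearMap.star_eq_adjoint,
      ContinuousLinearMap.adjoint_inner_left]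

@[simp]
theorem sigma_apply (a : C(X, ℂ)) (ξ : L2 Γ H) (t : Γ) :
    sigma Γ π a ξ t = π (act t⁻¹ a) (ξ t) := rfl

theorem leftReg_mul_sigma (s : Γ) (a : C(X, ℂ)) :
    leftReg Γ H s * sigma Γ π a = sigma Γ π (act s a) * leftReg Γ H s := by
  ext ξ t
  simp [← act_mul]

/-- The reduced crossed product `C(X) ⋊_r Γ`, realised on `ℓ²(Γ, H)`: the C*-algebra generated by
the operators `σ(a)`, `a ∈ C(X)`, and `λ(s)`, `s ∈ Γ`. -/
def reducedCrossedProduct (Γ : Type*) [Group Γ] {X : Type*} [TopologicalSpace X] [CompactSpace X]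
    [MulAction Γ X] [ContinuousConstSMul Γ X]
    {H : Type*} [NormedAddCommGroup H] [InnerProductSpace ℂ H] [CompleteSpace H]
    (π : C(X, ℂ) →⋆ₐ[ℂ] (H →L[ℂ] H)) : StarSubalgebra ℂ (L2 Γ H →L[ℂ] L2 Γ H) :=
  (StarAlgebra.adjoin ℂ (Set.range (sigma Γ π) ∪ Set.range (leftReg Γ H))).topologicalClosure

/-- The reduced group C*-algebra `C*_r(Γ)`, realised on `ℓ²(Γ, H)`: the C*-algebra generated by the
operators `λ(s)`, `s ∈ Γ`. -/
def reducedGroupAlgebra (Γ : Type*) [Group Γ]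
    (H : Type*) [NormedAddCommGroup H] [InnerProductSpace ℂ H] [CompleteSpace H] :
    StarSubalgebra ℂ (L2 Γ H →L[ℂ] L2 Γ H) :=
  (StarAlgebra.adjoin ℂ (Set.range (leftReg Γ H))).topologicalClosure

theorem sigma_mul_leftReg_mem (a : C(X, ℂ)) (s : Γ) :
    sigma Γ π a * leftReg Γ H s ∈ reducedCrossedProduct Γ π :=
  StarSubalgebra.le_topologicalClosure _ (mul_mem
    (StarAlgebra.subset_adjoin ℂ _ (Or.inl ⟨a, rfl⟩))
    (StarAlgebra.subset_adjoin ℂ _ (Or.inr ⟨s, rfl⟩)))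

/-- The linear span of the operators `σ(a) λ(s)`. -/
def crossedSpan (Γ : Type*) [Group Γ] {X : Type*} [TopologicalSpace X] [CompactSpace X]
    [MulAction Γ X] [ContinuousConstSMul Γ X]
    {H : Type*} [NormedAddCommGroup H] [InnerProductSpace ℂ H] [CompleteSpace H]
    (π : C(X, ℂ) →⋆ₐ[ℂ] (H →L[ℂ] H)) : Submodule ℂ (L2 Γ H →L[ℂ] L2 Γ H) :=
  Submodule.span ℂ (Set.range fun p : C(X, ℂ) × Γ => sigma Γ π p.1 * leftReg Γ H p.2)

theorem adjoin_eq_crossedSpan :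
    ((StarAlgebra.adjoin ℂ (Set.range (sigma Γ π) ∪ Set.range (leftReg Γ H)) :
      StarSubalgebra ℂ (L2 Γ H →L[ℂ] L2 Γ H)) : Set (L2 Γ H →L[ℂ] L2 Γ H)) =
      crossedSpan Γ π := by
  have hgen : ∀ (a : C(X, ℂ)) (s : Γ), sigma Γ π a * leftReg Γ H s ∈ crossedSpan Γ π :=
    fun a s => Submodule.subset_span ⟨(a, s), rfl⟩
  apply Set.Subset.antisymm
  · intro T hT
    refine StarAlgebra.adjoin_induction (p := fun T _ => T ∈ crossedSpan Γ π) ?_ ?_ ?_ ?_ ?_ hT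
    · rintro _ (⟨a, rfl⟩ | ⟨s, rfl⟩)
      · simpa using hgen a 1
      · simpa using hgen 1 s
    · intro c
      rw [Algebra.algebraMap_eq_smul_one]
      exact Submodule.smul_mem _ _ (by simpa using hgen 1 1)
    · intro x y _ _ hx hy
      exact add_mem hx hy
    · intro x y _ _ hx hy
      have := Submodule.mul_mem_mul hx hy
      rw [crossedSpan, Submodule.span_mul_span] at this
      refine (Submodule.span_le.2 ?_) this
      rintro _ ⟨_, ⟨⟨a, s⟩, rfl⟩, _, ⟨⟨b, t⟩, rfl⟩, rfl⟩
      have h : sigma Γ π a * leftReg Γ H s * (sigma Γ π b * leftReg Γ H t) =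
          sigma Γ π (a * act s b) * leftReg Γ H (s * t) := by
        rw [map_mul, map_mul, mul_assoc, ← mul_assoc (leftReg Γ H s), leftReg_mul_sigma]
        simp only [mul_assoc]
      simpa only [SetLike.mem_coe, h] using hgen (a * act s b) (s * t)
    · intro x hmem hx
      clear hmem
      induction hx using Submodule.span_induction with
      | mem x hx =>
        obtain ⟨⟨a, s⟩, rfl⟩ := hx
        simp only [star_mul, star_leftReg, ← map_star, leftReg_mul_sigma]
        exact hgen _ _
      | zero => simp
      | add x y _ _ hx hy => simpa using add_mem hx hy
      | smul c x _ hx => simpa using Submodule.smul_mem _ (star c) hx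
  · intro T hT
    refine Submodule.span_induction (p := fun T _ => T ∈
      (StarAlgebra.adjoin ℂ (Set.range (sigma Γ π) ∪ Set.range (leftReg Γ H)) :
      StarSubalgebra ℂ (L2 Γ H →L[ℂ] L2 Γ H))) ?_ ?_ ?_ ?_ hT
    · rintro _ ⟨⟨a, s⟩, rfl⟩
      exact mul_mem (StarAlgebra.subset_adjoin ℂ _ (Or.inl ⟨a, rfl⟩))
        (StarAlgebra.subset_adjoin ℂ _ (Or.inr ⟨s, rfl⟩))
    · exact zero_mem _
    · intro x y _ _ hx hy
      exact add_mem hx hy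
    · intro c x _ hx
      exact SMulMemClass.smul_mem c hx

/-- The reduced crossed product is the norm closure of the span of the operators `σ(a) λ(s)`. -/
theorem coe_reducedCrossedProduct :
    (reducedCrossedProduct Γ π : Set (L2 Γ H →L[ℂ] L2 Γ H)) = closure (crossedSpan Γ π) := by
  rw [reducedCrossedProduct, StarSubalgebra.topologicalClosure_coe, adjoin_eq_crossedSpan]

open Classical in
/-- The compression `T ↦ T_{e,e} ∈ B(H)` of an operator on `ℓ²(Γ, H)` to the coordinate `e ∈ Γ`. -/
def compression (Γ : Type*) [Group Γ]
    (H : Type*) [NormedAddCommGroup H] [InnerProductSpace ℂ H] :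
    (L2 Γ H →L[ℂ] L2 Γ H) →ₗ[ℂ] (H →L[ℂ] H) where
  toFun T := (lp.evalCLM ℂ (fun _ : Γ => H) 2 1).comp
    (T.comp (lp.singleContinuousLinearMap ℂ (fun _ : Γ => H) 2 1))
  map_add' _ _ := rfl
  map_smul' _ _ := rfl

open Classical in
theorem compression_apply (T : L2 Γ H →L[ℂ] L2 Γ H) (v : H) :
    compression Γ H T v = T (lp.single 2 (1 : Γ) v) 1 := rfl

theorem norm_compression_le (T : L2 Γ H →L[ℂ] L2 Γ H) : ‖compression Γ H T‖ ≤ ‖T‖ := by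
  classical
  refine ContinuousLinearMap.opNorm_le_bound _ (norm_nonneg _) fun v => ?_
  rw [compression_apply]
  refine (lp.norm_apply_le_norm (by norm_num) _ _).trans ((T.le_opNorm _).trans ?_)
  rw [lp.norm_single (by norm_num)]

theorem continuous_compression : Continuous (compression Γ H) :=
  AddMonoidHomClass.continuous_of_bound (compression Γ H) 1 fun T => by
    simpa using norm_compression_le T

open Classical in
theorem compression_sigma_mul_leftReg (a : C(X, ℂ)) (s : Γ) :
    compression Γ H (sigma Γ π a * leftReg Γ H s) = if s = 1 then π a else 0 := by
  ext v
  rw [compression_apply]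
  by_cases hs : s = 1
  · subst hs
    simp [act_one]
  · simp [hs, lp.single_apply]

theorem compression_mem_range (hπ : Function.Injective π) {T : L2 Γ H →L[ℂ] L2 Γ H}
    (hT : T ∈ reducedCrossedProduct Γ π) :
    compression Γ H T ∈ LinearMap.range (π : C(X, ℂ) →ₗ[ℂ] (H →L[ℂ] H)) := by
  classical
  have hcl : IsClosed ((LinearMap.range (π : C(X, ℂ) →ₗ[ℂ] (H →L[ℂ] H)) :
      Submodule ℂ (H →L[ℂ] H)) : Set (H →L[ℂ] H)) :=
    (NonUnitalStarAlgHom.isometry π hπ).isClosedEmbedding.isClosed_range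
  have hT' : T ∈ closure (crossedSpan Γ π : Set (L2 Γ H →L[ℂ] L2 Γ H)) := by
    rw [← coe_reducedCrossedProduct]
    exact hT
  suffices hle : crossedSpan Γ π ≤ Submodule.comap (compression Γ H)
      (LinearMap.range (π : C(X, ℂ) →ₗ[ℂ] (H →L[ℂ] H))) from
    closure_minimal hle (hcl.preimage continuous_compression) hT'
  refine Submodule.span_le.2 ?_
  rintro _ ⟨⟨a, s⟩, rfl⟩
  simp only [Submodule.comap_coe, Set.mem_preimage, compression_sigma_mul_leftReg]
  split_ifs
  · exact ⟨a, rfl⟩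
  · exact zero_mem _

/-- The canonical conditional expectation `𝔼 : C(X) ⋊_r Γ → C(X)`: for a faithful representation
`π`, the function `𝔼(T)` is the unique `f ∈ C(X)` such that `π(f)` is the compression of `T` to the
coordinate `e`. It sends `σ(a) λ(s)` to `a` if `s = e` and to `0` otherwise. -/
def condExp (Γ : Type*) [Group Γ] {X : Type*} [TopologicalSpace X] [CompactSpace X]
    [MulAction Γ X] [ContinuousConstSMul Γ X]
    {H : Type*} [NormedAddCommGroup H] [InnerProductSpace ℂ H] [CompleteSpace H]
    (π : C(X, ℂ) →⋆ₐ[ℂ] (H →L[ℂ] H)) (hπ : Function.Injective π) :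
    reducedCrossedProduct Γ π →L[ℂ] C(X, ℂ) :=
  LinearMap.mkContinuous
    ((LinearEquiv.ofInjective (π : C(X, ℂ) →ₗ[ℂ] (H →L[ℂ] H)) hπ).symm.toLinearMap ∘ₗ
      ((compression Γ H ∘ₗ
        (reducedCrossedProduct Γ π).toSubalgebra.toSubmodule.subtype).codRestrict _
          fun T => compression_mem_range π hπ T.2)) 1 (by
    intro T
    rw [one_mul, ← NonUnitalStarAlgHom.norm_map π hπ]
    refine le_trans (le_of_eq (congrArg norm ?_)) (norm_compression_le T.1)
    exact congrArg Subtype.val ((LinearEquiv.ofInjective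
      (π : C(X, ℂ) →ₗ[ℂ] (H →L[ℂ] H)) hπ).apply_symm_apply _))

theorem rep_condExp (hπ : Function.Injective π) (T : reducedCrossedProduct Γ π) :
    π (condExp Γ π hπ T) = compression Γ H T.1 :=
  congrArg Subtype.val ((LinearEquiv.ofInjective
    (π : C(X, ℂ) →ₗ[ℂ] (H →L[ℂ] H)) hπ).apply_symm_apply _)

open Classical in
/-- The defining formula of the canonical conditional expectation; by linearity and continuity it
determines `𝔼`. -/
theorem condExp_sigma_mul_leftReg (hπ : Function.Injective π) (a : C(X, ℂ)) (s : Γ) :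
    condExp Γ π hπ ⟨sigma Γ π a * leftReg Γ H s, sigma_mul_leftReg_mem π a s⟩ =
      if s = 1 then a else 0 := by
  apply hπ
  rw [rep_condExp, compression_sigma_mul_leftReg]
  split_ifs
  · rfl
  · exact (map_zero π).symm

/-- The crossed product `C(X) ⋊_r Γ` is almost reflecting: every intermediate C*-algebra
`C*_r(Γ) ⊆ A ⊆ C(X) ⋊_r Γ` satisfies `𝔼(A) ⊆ A`, where `C(X)` is regarded as a subalgebra of the
crossed product by means of `σ`. -/
def AlmostReflecting (Γ : Type*) [Group Γ] {X : Type*} [TopologicalSpace X] [CompactSpace X]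
    [MulAction Γ X] [ContinuousConstSMul Γ X]
    {H : Type*} [NormedAddCommGroup H] [InnerProductSpace ℂ H] [CompleteSpace H]
    (π : C(X, ℂ) →⋆ₐ[ℂ] (H →L[ℂ] H)) (hπ : Function.Injective π) : Prop :=
  ∀ A : StarSubalgebra ℂ (L2 Γ H →L[ℂ] L2 Γ H),
    IsClosed (A : Set (L2 Γ H →L[ℂ] L2 Γ H)) → reducedGroupAlgebra Γ H ≤ A →
      A ≤ reducedCrossedProduct Γ π →
        ∀ T : reducedCrossedProduct Γ π, T.1 ∈ A → sigma Γ π (condExp Γ π hπ T) ∈ A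

end Flow

end CrossedProduct

end

/-!
Let `T` belong to an intermediate C*-algebra `A` and put `f = 𝔼(T)`. Every average
`(1/m) ∑ⱼ λ(sⱼ) T λ(sⱼ)*` belongs to `A`, because `A` contains `C*_r(Γ)`. Such averages approximate
`σ(f)` when the `sⱼ` come from plumpness of the set of those `s` that almost fix `f`. Indeed, up to
a small error `T` is a finite sum of operators `σ(a) λ(t)`, and
`λ(s) σ(a) λ(t) λ(s)* = σ(s.a) λ(s t s⁻¹)`. The term with `t = e` has coefficient close to `f`, so
its average stays close to `σ(f)`. The terms with `t ≠ e` are averaged to almost zero.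

For the last claim the coefficients `sⱼ.a` vary with `j` and are not assumed to be almost fixed. This
is harmless: replacing a vector `ξ` by the scalar vector `t ↦ ‖ξ(t)‖` shows that
`‖∑ⱼ σ(bⱼ) λ(gⱼ)‖ ≤ (maxⱼ ‖bⱼ‖) ‖∑ⱼ λ(gⱼ)‖`, with the norm on the right taken on `ℓ²(Γ)`. This
domination is `norm_sum_sigma_mul_leftReg_le`; the approximation for finite sums is
`exists_conjAverage_sub_sigma_le`.
-/

noncomputable section

namespace CrossedProduct

section Domination

variable {Γ : Type*} {H : Type*} [NormedAddCommGroup H]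

/-- The scalar vector `t ↦ ‖ξ(t)‖` in `ℓ²(Γ)` attached to a vector `ξ` of `ℓ²(Γ, H)`. -/
def absVec (ξ : L2 Γ H) : L2 Γ ℂ :=
  ⟨fun t => (‖ξ t‖ : ℂ), (lp.memℓp ξ).mono' fun t => by simp⟩

@[simp]
theorem absVec_apply (ξ : L2 Γ H) (t : Γ) : absVec ξ t = (‖ξ t‖ : ℂ) := rfl

theorem norm_absVec_le (ξ : L2 Γ H) : ‖absVec ξ‖ ≤ ‖ξ‖ :=
  lp.norm_mono (by norm_num) fun t => by simp

end Domination

section Average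

variable {Γ : Type*} [Group Γ] {H : Type*} [NormedAddCommGroup H] [InnerProductSpace ℂ H]

theorem norm_leftReg_le (s : Γ) : ‖leftReg Γ H s‖ ≤ 1 := by
  change ‖translation H s‖ ≤ 1
  unfold translation
  exact LinearMap.mkContinuous_norm_le _ zero_le_one _

theorem norm_inv_smul_sum_le {E : Type*} [SeminormedAddCommGroup E] [NormedSpace ℂ E] {m : ℕ}
    (hm : 0 < m) (x : Fin m → E) {r : ℝ} (hx : ∀ j, ‖x j‖ ≤ r) :
    ‖(m : ℂ)⁻¹ • ∑ j, x j‖ ≤ r := by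
  have hm' : (0 : ℝ) < m := by exact_mod_cast hm
  rw [norm_smul, norm_inv, Complex.norm_natCast, inv_mul_le_iff₀ hm']
  simpa using norm_sum_le_of_le Finset.univ fun j _ => hx j

/-- The average `(1/m) ∑ⱼ λ(sⱼ) T λ(sⱼ)*` of conjugates of an operator `T` on `ℓ²(Γ, H)`, as a
linear map in `T`; the adjoint `λ(s)*` is written as `λ(s⁻¹)`. -/
def conjAverage {m : ℕ} (s : Fin m → Γ) :
    (L2 Γ H →L[ℂ] L2 Γ H) →ₗ[ℂ] (L2 Γ H →L[ℂ] L2 Γ H) where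
  toFun T := (m : ℂ)⁻¹ • ∑ j, leftReg Γ H (s j) * T * leftReg Γ H (s j)⁻¹
  map_add' T U := by simp only [mul_add, add_mul, Finset.sum_add_distrib, smul_add]
  map_smul' c T := by
    simp only [mul_smul_comm, smul_mul_assoc, ← Finset.smul_sum, RingHom.id_apply]
    rw [smul_comm]

theorem conjAverage_apply {m : ℕ} (s : Fin m → Γ) (T : L2 Γ H →L[ℂ] L2 Γ H) :
    conjAverage s T = (m : ℂ)⁻¹ • ∑ j, leftReg Γ H (s j) * T * leftReg Γ H (s j)⁻¹ := rfl

theorem norm_conjAverage_le {m : ℕ} (hm : 0 < m) (s : Fin m → Γ) (T : L2 Γ H →L[ℂ] L2 Γ H) :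
    ‖conjAverage s T‖ ≤ ‖T‖ := by
  rw [conjAverage_apply]
  refine norm_inv_smul_sum_le (E := L2 Γ H →L[ℂ] L2 Γ H) hm _ fun j => ?_
  calc ‖leftReg Γ H (s j) * T * leftReg Γ H (s j)⁻¹‖
      ≤ ‖leftReg Γ H (s j)‖ * ‖T‖ * ‖leftReg Γ H (s j)⁻¹‖ :=
        (ContinuousLinearMap.opNorm_comp_le _ _).trans (mul_le_mul_of_nonneg_right
          (ContinuousLinearMap.opNorm_comp_le _ _) (norm_nonneg _))
    _ ≤ 1 * ‖T‖ * 1 := by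
        gcongr <;> exact norm_leftReg_le _
    _ = ‖T‖ := by ring

theorem leftReg_mem_reducedGroupAlgebra [CompleteSpace H] (s : Γ) :
    leftReg Γ H s ∈ reducedGroupAlgebra Γ H :=
  StarSubalgebra.le_topologicalClosure _ (StarAlgebra.subset_adjoin ℂ _ ⟨s, rfl⟩)

theorem conjAverage_mem [CompleteSpace H] {A : StarSubalgebra ℂ (L2 Γ H →L[ℂ] L2 Γ H)}
    (hA : reducedGroupAlgebra Γ H ≤ A) {m : ℕ} (s : Fin m → Γ) {T : L2 Γ H →L[ℂ] L2 Γ H}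
    (hT : T ∈ A) : conjAverage s T ∈ A :=
  SMulMemClass.smul_mem _ (sum_mem fun _ _ => mul_mem
    (mul_mem (hA (leftReg_mem_reducedGroupAlgebra _)) hT)
    (hA (leftReg_mem_reducedGroupAlgebra _)))

end Average

section Crossed

variable {Γ : Type*} [Group Γ] {X : Type*} [TopologicalSpace X] [CompactSpace X]
  [MulAction Γ X] [ContinuousConstSMul Γ X]
  {H : Type*} [NormedAddCommGroup H] [InnerProductSpace ℂ H] [CompleteSpace H]
  (π : C(X, ℂ) →⋆ₐ[ℂ] (H →L[ℂ] H))

/-- Bounded coefficients in `C(X)` can be removed from a sum of translations at the cost of their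
bound, because the sum applied to `ξ` is dominated pointwise by the scalar sum of translations
applied to `t ↦ ‖ξ(t)‖`. -/
theorem norm_sum_sigma_mul_leftReg_le {ι : Type*} [Fintype ι] (b : ι → C(X, ℂ)) (g : ι → Γ)
    {M : ℝ} (hM : 0 ≤ M) (hb : ∀ j, ‖b j‖ ≤ M) :
    ‖∑ j, sigma Γ π (b j) * leftReg Γ H (g j)‖ ≤ M * ‖∑ j, leftReg Γ ℂ (g j)‖ := by
  refine ContinuousLinearMap.opNorm_le_bound _ (by positivity) fun ξ => ?_
  have key : ‖(∑ j, sigma Γ π (b j) * leftReg Γ H (g j)) ξ‖ ≤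
      ‖(M : ℂ) • (∑ j, leftReg Γ ℂ (g j)) (absVec ξ)‖ := by
    refine lp.norm_mono (by norm_num) fun t => ?_
    have hsum : ((M : ℂ) • (∑ j, leftReg Γ ℂ (g j)) (absVec ξ)) t =
        ((M * ∑ j, ‖ξ ((g j)⁻¹ * t)‖ : ℝ) : ℂ) := by
      rw [lp.coeFn_smul, Pi.smul_apply, _root_.sum_apply, lp.coeFn_sum, Finset.sum_apply,
        smul_eq_mul]
      push_cast
      rfl
    rw [hsum, Complex.norm_real, Real.norm_of_nonneg (by positivity),
      _root_.sum_apply, lp.coeFn_sum, Finset.sum_apply, Finset.mul_sum]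
    exact norm_sum_le_of_le _ fun j _ => (norm_rep_act_apply_le π t (b j) _).trans
      (mul_le_mul_of_nonneg_right (hb j) (norm_nonneg _))
  refine key.trans ?_
  rw [norm_smul, Complex.norm_real, Real.norm_of_nonneg hM, mul_assoc]
  gcongr
  exact (ContinuousLinearMap.le_opNorm _ _).trans (by gcongr; exact norm_absVec_le ξ)

theorem leftReg_conj_sigma_mul_leftReg (s t : Γ) (a : C(X, ℂ)) :
    leftReg Γ H s * (sigma Γ π a * leftReg Γ H t) * leftReg Γ H s⁻¹ =
      sigma Γ π (act s a) * leftReg Γ H (s * t * s⁻¹) := by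
  rw [← mul_assoc, leftReg_mul_sigma, map_mul, map_mul]
  simp only [mul_assoc]

/-- For `T` in the linear span of the operators `σ(a) λ(t)`, with `e`-coefficient `a`, the averaged
conjugate of `T` differs from `σ((1/m) ∑ⱼ sⱼ.a)` by at most a constant multiple of any common bound
for the averages of `λ(sⱼ t sⱼ⁻¹)`, where `t` runs through a finite set `F` of non-identity elements
occurring in an expression of `T` as a sum. The constant and `F` do not depend on the `sⱼ`. -/
theorem exists_conjAverage_sub_sigma_le {T : L2 Γ H →L[ℂ] L2 Γ H} (hT : T ∈ crossedSpan Γ π) :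
    ∃ (a : C(X, ℂ)) (C : ℝ) (F : Finset Γ), compression Γ H T = π a ∧ 0 ≤ C ∧ (1 : Γ) ∉ F ∧
      ∀ (m : ℕ) (s : Fin m → Γ) (δ : ℝ), 0 < δ →
        (∀ t ∈ F, ‖(m : ℂ)⁻¹ • ∑ j, leftReg Γ ℂ (s j * t * (s j)⁻¹)‖ ≤ δ) →
        ‖conjAverage s T - sigma Γ π ((m : ℂ)⁻¹ • ∑ j, act (s j) a)‖ ≤ C * δ := by
  classical
  induction hT using Submodule.span_induction with
  | mem T hT =>
    obtain ⟨⟨a, t⟩, rfl⟩ := hT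
    dsimp only
    by_cases ht : t = 1
    · subst ht
      refine ⟨a, 0, ∅, by rw [compression_sigma_mul_leftReg, if_pos rfl], le_rfl, by simp,
        fun m s δ _ _ => ?_⟩
      simp only [conjAverage_apply, leftReg_conj_sigma_mul_leftReg, mul_one, mul_inv_cancel]
      simp only [map_one, mul_one, map_smul, map_sum, sub_self, norm_zero, zero_mul, le_refl]
    · refine ⟨0, ‖a‖, {t}, by simp [compression_sigma_mul_leftReg, ht], norm_nonneg _,
        by simpa using Ne.symm ht, fun m s δ _ h => ?_⟩
      have h := h t (Finset.mem_singleton_self t)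
      rw [norm_smul] at h
      simp only [conjAverage_apply, leftReg_conj_sigma_mul_leftReg, map_zero,
        Finset.sum_const_zero, smul_zero, sub_zero]
      rw [norm_smul]
      calc ‖(m : ℂ)⁻¹‖ * ‖∑ j, sigma Γ π (act (s j) a) * leftReg Γ H (s j * t * (s j)⁻¹)‖
          ≤ ‖(m : ℂ)⁻¹‖ * (‖a‖ * ‖∑ j, leftReg Γ ℂ (s j * t * (s j)⁻¹)‖) := by
            gcongr
            exact norm_sum_sigma_mul_leftReg_le π _ _ (norm_nonneg a) fun j => norm_act_le _ _
        _ = ‖a‖ * (‖(m : ℂ)⁻¹‖ * ‖∑ j, leftReg Γ ℂ (s j * t * (s j)⁻¹)‖) := by ring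
        _ ≤ ‖a‖ * δ := by gcongr
  | zero => exact ⟨0, 0, ∅, by simp, le_rfl, by simp, fun m s δ _ _ => by simp⟩
  | add T U _ _ hT hU =>
    obtain ⟨a, C, F, ha, hC, hF, h⟩ := hT
    obtain ⟨b, D, G, hb, hD, hG, k⟩ := hU
    refine ⟨a + b, C + D, F ∪ G, by rw [map_add, map_add, ha, hb], by positivity,
      by simp [hF, hG], fun m s δ hδ hFG => ?_⟩
    have h := h m s δ hδ fun t ht => hFG t (Finset.mem_union_left _ ht)
    have k := k m s δ hδ fun t ht => hFG t (Finset.mem_union_right _ ht)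
    simp only [map_add, Finset.sum_add_distrib, smul_add]
    rw [add_sub_add_comm, add_mul]
    exact norm_add_le_of_le h k
  | smul c T _ hT =>
    obtain ⟨a, C, F, ha, hC, hF, h⟩ := hT
    refine ⟨c • a, ‖c‖ * C, F, by rw [map_smul, map_smul, ha], by positivity, hF,
      fun m s δ hδ hFG => ?_⟩
    have h := h m s δ hδ hFG
    have hsum : (m : ℂ)⁻¹ • ∑ j, act (s j) (c • a) = c • ((m : ℂ)⁻¹ • ∑ j, act (s j) a) := by
      simp only [map_smul, ← Finset.smul_sum]
      rw [smul_comm]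
    rw [hsum, map_smul, map_smul, ← smul_sub, norm_smul, mul_assoc]
    gcongr

end Crossed

end CrossedProduct

end

open CrossedProduct in
theorem theorem3p4 {Γ X H : Type*} [Group Γ] [Countable Γ]
    [TopologicalSpace X] [CompactSpace X] [MulAction Γ X] [ContinuousConstSMul Γ X]
    [NormedAddCommGroup H] [InnerProductSpace ℂ H] [CompleteSpace H]
    (hplump : ∀ (f : C(X, ℂ)) (ε : ℝ), 0 < ε →
      CrossedProduct.IsPlump (CrossedProduct.almostFixing Γ f ε))
    (π : C(X, ℂ) →⋆ₐ[ℂ] (H →L[ℂ] H)) (hπ : Function.Injective π) :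
    CrossedProduct.AlmostReflecting Γ π hπ := by
  intro A hAcl hA _ T hTA
  set f := condExp Γ π hπ T with hf
  rw [← SetLike.mem_coe, ← hAcl.closure_eq, Metric.mem_closure_iff]
  intro ε hε
  have hT : T.1 ∈ closure (crossedSpan Γ π : Set (L2 Γ H →L[ℂ] L2 Γ H)) := by
    rw [← coe_reducedCrossedProduct]
    exact T.2
  -- Four errors, each less than `ε / 4` or at most `ε / 4`, add up below: the approximation of `T`
  -- by `S`, the averaged terms off `e`, the passage from `a` to `f`, and the motion of `f`.
  obtain ⟨S, hS, hTS⟩ := Metric.mem_closure_iff.1 hT (ε / 4) (by positivity)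
  rw [dist_eq_norm] at hTS
  obtain ⟨a, C, F, ha, hC, hF, h⟩ := exists_conjAverage_sub_sigma_le π hS
  obtain ⟨m, s, hm, hs, hF⟩ := (hplump f (ε / 4) (by positivity)).2 (ε / (4 * (C + 1)))
    (by positivity) F hF
  have hoff := h m s _ (by positivity) fun t ht => (hF t ht).le
  have hC' : C * (ε / (4 * (C + 1))) ≤ ε / 4 := by
    rw [mul_div_assoc', div_le_div_iff₀ (by positivity) (by norm_num)]
    nlinarith
  have haf : ‖f - a‖ ≤ ‖T.1 - S‖ := by
    rw [← NonUnitalStarAlgHom.norm_map π hπ, map_sub, hf, rep_condExp, ← ha, ← map_sub]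
    exact norm_compression_le _
  have hcoef : ‖(m : ℂ)⁻¹ • ∑ j, act (s j) a - f‖ ≤ ε / 4 + ε / 4 := by
    have hmean : (m : ℂ)⁻¹ • ∑ j, act (s j) a - f = (m : ℂ)⁻¹ • ∑ j, (act (s j) a - f) := by
      have hm' : (m : ℂ) ≠ 0 := by exact_mod_cast hm.ne'
      rw [Finset.sum_sub_distrib, smul_sub, Finset.sum_const, Finset.card_univ, Fintype.card_fin,
        ← Nat.cast_smul_eq_nsmul ℂ, inv_smul_smul₀ hm']
    rw [hmean]
    refine norm_inv_smul_sum_le hm _ fun j => ?_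
    have hsplit : act (s j) a - f = act (s j) (a - f) + (act (s j) f - f) := by
      rw [map_sub]
      abel
    rw [hsplit]
    refine norm_add_le_of_le ((norm_act_le _ _).trans ?_) (hs j).le
    rw [norm_sub_rev]
    exact haf.trans hTS.le
  refine ⟨conjAverage s T.1, conjAverage_mem hA s hTA, ?_⟩
  rw [dist_comm, dist_eq_norm]
  have hdecomp : conjAverage s T.1 - sigma Γ π f = conjAverage s (T.1 - S) +
      ((conjAverage s S - sigma Γ π ((m : ℂ)⁻¹ • ∑ j, act (s j) a)) +
        sigma Γ π ((m : ℂ)⁻¹ • ∑ j, act (s j) a - f)) := by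
    rw [map_sub, map_sub]
    abel
  rw [hdecomp]
  have h1 := norm_conjAverage_le hm s (T.1 - S)
  have h3 := NonUnitalStarAlgHom.norm_apply_le (sigma Γ π)
    ((m : ℂ)⁻¹ • ∑ j, act (s j) a - f)
  have h4 := norm_add₃_le (a := conjAverage s (T.1 - S))
    (b := conjAverage s S - sigma Γ π ((m : ℂ)⁻¹ • ∑ j, act (s j) a))
    (c := sigma Γ π ((m : ℂ)⁻¹ • ∑ j, act (s j) a - f))
  rw [add_assoc] at h4
  linarith
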